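/- Let $n\ge 1$ and let $B_n$ be the group of all bijections $\sigma$ of $[\pm n]=\{-n,\dots,-1,1,\dots,n\}$ with $\sigma(-a)=-\sigma(a)$ for all $a\in[\pm n]$, under composition; write $\sigma=[\sigma(1),\dots,\sigma(n)]$. Let $s_0=[-1,2,\dots,n]$ and, for $1\le i<n$, let $s_i=[1,\dots,i-1,i+1,i,i+2,\dots,n]$. For $\sigma\in B_n$ let $\ell_B(\sigma)$ be the least $r\ge 0$ such that $\sigma$ is a product of $r$ elements of $\{s_0,s_1,\dots,s_{n-1}\}$. Let $D_n\le B_n$ be the subgroup of all $\sigma\in B_n$ for which the number of $i\in\{1,\dots,n\}$ with $\sigma(i)<0$ is even. For $\sigma\in D_n$ let $\ell_D(\sigma)$ be the least $r\ge 0$ such that $\sigma$ is a product of $r$ Coxeter generators of $D_n$; these are $s_1,\dots,s_{n-1}$ and, if $n\ge 2$, also $[-2,-1,3,\dots,n]$. For an indeterminate $q$ put $[m]_q=1+q+\dots+q^{m-1}$. Then, in $\mathbb{Z}[q]$, $$\sum_{\sigma\in D_n}q^{\ell_D(\sigma)}=\sum_{\sigma\in B_n,\ \sigma(n)>0}q^{\ell_B(\sigma)},$$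 and both sums are equal to $[n]_q\cdot\prod_{j=1}^{n-1}[2j]_q$. -/

import Mathlib

open scoped Polynomial

namespace SignedPerm

/-- The set `[±n] = {-n, …, -1, 1, …, n}`. -/
abbrev PM (n : ℕ) : Type := {a : ℤ // a ≠ 0 ∧ -(n : ℤ) ≤ a ∧ a ≤ n}

instance (n : ℕ) : Fintype (PM n) :=
  Fintype.subtype
    (((Finset.range (2 * n + 1)).image (fun k : ℕ => (k : ℤ) - n)).filter (fun a => a ≠ 0)) (by
      intro a
      simp only [Finset.mem_filter, Finset.mem_image, Finset.mem_range]
      constructor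
      · rintro ⟨⟨k, hk, rfl⟩, h⟩
        omega
      · rintro ⟨h, h1, h2⟩
        exact ⟨⟨(a + n).toNat, by omega, by omega⟩, h⟩)

instance (n : ℕ) : Neg (PM n) := ⟨fun a => ⟨-a.1, by have := a.2; omega⟩⟩

@[simp] theorem coe_neg {n : ℕ} (a : PM n) : ((-a : PM n) : ℤ) = -(a : ℤ) := rfl

theorem neg_neg' {n : ℕ} (a : PM n) : -(-a) = a := Subtype.ext (by simp)

/-- The element `i` of `[±n]`, for `1 ≤ i ≤ n`. -/
def pt {n : ℕ} (i : ℕ) (h1 : 1 ≤ i) (h2 : i ≤ n) : PM n :=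
  ⟨(i : ℤ), by omega, by omega, by omega⟩

@[simp] theorem coe_pt {n : ℕ} (i : ℕ) (h1 : 1 ≤ i) (h2 : i ≤ n) :
    ((pt i h1 h2 : PM n) : ℤ) = i := rfl

/-- The hyperoctahedral group `B_n`: bijections `σ` of `[±n]` with `σ(-a) = -σ(a)`,
under composition. -/
def B (n : ℕ) : Subgroup (Equiv.Perm (PM n)) where
  carrier := {σ | ∀ a, σ (-a) = -σ a}
  mul_mem' := by
    intro σ τ hσ hτ a
    simp only [Set.mem_ofPred_eq] at hσ hτ
    simp [Equiv.Perm.mul_apply, hτ, hσ]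
  one_mem' := by intro a; rfl
  inv_mem' := by
    intro σ hσ a
    simp only [Set.mem_ofPred_eq] at hσ
    rw [Equiv.Perm.inv_eq_iff_eq, hσ]
    simp

theorem mem_B {n : ℕ} {σ : Equiv.Perm (PM n)} : σ ∈ B n ↔ ∀ a, σ (-a) = -σ a := Iff.rfl

instance (n : ℕ) : DecidablePred (fun σ => σ ∈ B n) := fun _ => decidable_of_iff' _ mem_B

/-- The value `σ(a) ∈ [±n]`, for `σ ∈ B_n`. -/
def val {n : ℕ} (σ : B n) (a : PM n) : PM n := (σ : Equiv.Perm (PM n)) a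

/-- `neg(σ)`: the number of `i ∈ [n]` with `σ(i) < 0`. -/
def neg {n : ℕ} (σ : B n) : ℕ :=
  (Finset.univ.filter (fun i : PM n => 0 < (i : ℤ) ∧ (val σ i : ℤ) < 0)).card

/-- `s_0 = [-1, 2, …, n]`. -/
def s0 {n : ℕ} (h : 1 ≤ n) : B n :=
  ⟨Equiv.swap (pt 1 le_rfl h) (-pt 1 le_rfl h), by
    rw [mem_B]
    intro a
    simp only [Equiv.swap_apply_def, Subtype.ext_iff, coe_neg, coe_pt]
    split_ifs <;> simp only [coe_neg, coe_pt] <;> omega⟩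

/-- `s_i = [1, …, i-1, i+1, i, i+2, …, n]`, for `1 ≤ i < n`. -/
def s {n : ℕ} (i : ℕ) (h1 : 1 ≤ i) (h2 : i < n) : B n :=
  ⟨Equiv.swap (pt i h1 h2.le) (pt (i + 1) (by omega) h2) *
      Equiv.swap (-pt i h1 h2.le) (-pt (i + 1) (by omega) h2), by
    rw [mem_B]
    intro a
    simp only [Equiv.Perm.mul_apply, Equiv.swap_apply_def, Subtype.ext_iff, coe_neg, coe_pt]
    split_ifs <;> (try simp only [coe_neg, coe_pt] at *) <;> omega⟩

/-- The additional generator of type `D`: `[-2, -1, 3, …, n]`, for `n ≥ 2`. -/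
def s0D {n : ℕ} (h : 2 ≤ n) : B n :=
  ⟨Equiv.swap (pt 1 le_rfl (by omega)) (-pt 2 (by omega) h) *
      Equiv.swap (-pt 1 le_rfl (by omega)) (pt 2 (by omega) h), by
    rw [mem_B]
    intro a
    simp only [Equiv.Perm.mul_apply, Equiv.swap_apply_def, Subtype.ext_iff, coe_neg, coe_pt]
    split_ifs <;> (try simp only [coe_neg, coe_pt] at *) <;> omega⟩

/-- The Coxeter generators `s_0, s_1, …, s_{n-1}` of `B_n`. -/
def gensB (n : ℕ) : Set (B n) :=
  {g | (∃ h : 1 ≤ n, g = s0 h) ∨ ∃ (i : ℕ) (h1 : 1 ≤ i) (h2 : i < n), g = s i h1 h2}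

theorem val_neg {n : ℕ} (σ : B n) (a : PM n) : val σ (-a) = -val σ a := σ.2 a

theorem pow_neg_eq {n : ℕ} (σ : B n) :
    (-1 : ℤ) ^ neg σ =
      ∏ i ∈ Finset.univ.filter (fun i : PM n => 0 < (i : ℤ)), Int.sign (val σ i : ℤ) := by
  have h : ∀ i : PM n, Int.sign (val σ i : ℤ) = if (val σ i : ℤ) < 0 then -1 else 1 := by
    intro i
    have := (val σ i).2.1
    split_ifs with h
    · exact Int.sign_eq_neg_one_of_neg h
    · exact Int.sign_eq_one_of_pos (by omega)
  simp_rw [h]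
  rw [Finset.prod_ite, Finset.prod_const, Finset.prod_const_one, mul_one, Finset.filter_filter]
  rfl

/-- The absolute value on `[±n]`. -/
def absPM {n : ℕ} (a : PM n) : PM n := if 0 < (a : ℤ) then a else -a

theorem absPM_pos {n : ℕ} (a : PM n) : 0 < (absPM a : ℤ) := by
  have := a.2.1
  unfold absPM
  split_ifs with h
  · exact h
  · rw [coe_neg]; omega

theorem absPM_of_pos {n : ℕ} {a : PM n} (h : 0 < (a : ℤ)) : absPM a = a := if_pos h

theorem absPM_neg {n : ℕ} (a : PM n) : absPM (-a) = absPM a := by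
  have := a.2.1
  unfold absPM
  split_ifs with h1 h2 h2 <;> simp only [coe_neg, Subtype.ext_iff] at * <;> omega

theorem absPM_val_absPM {n : ℕ} (σ : B n) (a : PM n) :
    absPM (val σ (absPM a)) = absPM (val σ a) := by
  by_cases h : 0 < (a : ℤ)
  · rw [absPM_of_pos h]
  · rw [show absPM a = -a from if_neg h, val_neg, absPM_neg]

theorem sign_val {n : ℕ} (σ : B n) (a : PM n) :
    Int.sign (val σ a : ℤ) = Int.sign (val σ (absPM a) : ℤ) * Int.sign (a : ℤ) := by
  by_cases h : 0 < (a : ℤ)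
  · rw [absPM_of_pos h, Int.sign_eq_one_of_pos h, mul_one]
  · have := a.2.1
    rw [show absPM a = -a from if_neg h, val_neg, coe_neg, Int.sign_neg,
      Int.sign_eq_neg_one_of_neg (a := (a : ℤ)) (by omega)]
    ring

theorem pow_neg_mul {n : ℕ} (σ τ : B n) :
    (-1 : ℤ) ^ neg (σ * τ) = (-1) ^ neg σ * (-1) ^ neg τ := by
  have hv : ∀ (α β : B n) a, val (α * β) a = val α (val β a) := fun _ _ _ => rfl
  have h1 : ∀ a : PM n, val (1 : B n) a = a := fun _ => rfl
  rw [pow_neg_eq, pow_neg_eq, pow_neg_eq]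
  simp_rw [hv]
  rw [Finset.prod_congr rfl (fun i _ => sign_val σ (val τ i)), Finset.prod_mul_distrib]
  congr 1
  refine Finset.prod_nbij' (fun i => absPM (val τ i)) (fun i => absPM (val τ⁻¹ i)) ?_ ?_ ?_ ?_ ?_
  · intro i _; simpa using absPM_pos _
  · intro i _; simpa using absPM_pos _
  · intro i hi
    simp only [Finset.mem_filter, Finset.mem_univ, true_and] at hi
    rw [absPM_val_absPM, ← hv, inv_mul_cancel, h1, absPM_of_pos hi]
  · intro i hi
    simp only [Finset.mem_filter, Finset.mem_univ, true_and] at hi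
    rw [absPM_val_absPM, ← hv, mul_inv_cancel, h1, absPM_of_pos hi]
  · intro i _; rfl

/-- The Weyl group `D_n`: the subgroup of all `σ ∈ B_n` with `neg(σ)` even. -/
def D (n : ℕ) : Subgroup (B n) where
  carrier := {σ | Even (neg σ)}
  mul_mem' := by
    intro σ τ hσ hτ
    simp only [Set.mem_ofPred_eq, ← neg_one_pow_eq_one_iff_even (R := ℤ) (by norm_num)] at *
    rw [pow_neg_mul, hσ, hτ, mul_one]
  one_mem' := by
    have : neg (1 : B n) = 0 := by
      unfold neg
      rw [Finset.card_eq_zero, Finset.filter_eq_empty_iff]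
      intro i _ h
      exact absurd h.2 (not_lt.mpr h.1.le)
    simp [this]
  inv_mem' := by
    intro σ hσ
    have h := pow_neg_mul σ σ⁻¹
    have h1 := pow_neg_mul (1 : B n) 1
    simp only [Set.mem_ofPred_eq, ← neg_one_pow_eq_one_iff_even (R := ℤ) (by norm_num)] at *
    rw [mul_inv_cancel, hσ, one_mul] at h
    rw [← h]
    rw [mul_one] at h1
    rcases neg_one_pow_eq_or ℤ (neg (1 : B n)) with h2 | h2
    · exact h2
    · rw [h2] at h1; norm_num at h1

theorem mem_D {n : ℕ} {σ : B n} : σ ∈ D n ↔ Even (neg σ) := Iff.rfl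

instance (n : ℕ) : DecidablePred (fun σ => σ ∈ D n) := fun _ => decidable_of_iff' _ mem_D

theorem s_mem_D {n : ℕ} (i : ℕ) (h1 : 1 ≤ i) (h2 : i < n) : s i h1 h2 ∈ D n := by
  have : neg (s i h1 h2) = 0 := by
    unfold neg
    rw [Finset.card_eq_zero, Finset.filter_eq_empty_iff]
    rintro a - ⟨ha, hb⟩
    simp only [val, s, Equiv.Perm.mul_apply, Equiv.swap_apply_def, Subtype.ext_iff, coe_neg,
      coe_pt] at hb
    split_ifs at hb <;> (try simp only [coe_neg, coe_pt] at *) <;> omega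
  rw [mem_D, this]
  exact Even.zero

theorem s0D_mem_D {n : ℕ} (h : 2 ≤ n) : s0D h ∈ D n := by
  have : neg (s0D h) = 2 := by
    unfold neg
    rw [Finset.card_eq_two]
    refine ⟨pt 1 le_rfl (by omega), pt 2 (by omega) h, ?_, ?_⟩
    · simp [Subtype.ext_iff]
    · ext a
      simp only [Finset.mem_filter, Finset.mem_univ, true_and, Finset.mem_insert,
        Finset.mem_singleton, val, s0D, Equiv.Perm.mul_apply, Equiv.swap_apply_def,
        Subtype.ext_iff, coe_neg, coe_pt]
      split_ifs <;> (try simp only [coe_neg, coe_pt] at *) <;> omega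
  rw [mem_D, this]
  exact even_two

/-- The Coxeter generators of `D_n`: `[-2, -1, 3, …, n]` (if `n ≥ 2`) and
`s_1, …, s_{n-1}`. -/
def gensD (n : ℕ) : Set (D n) :=
  {g | (∃ h : 2 ≤ n, g = ⟨s0D h, s0D_mem_D h⟩) ∨
    ∃ (i : ℕ) (h1 : 1 ≤ i) (h2 : i < n), g = ⟨s i h1 h2, s_mem_D i h1 h2⟩}

/-- The length of `g` with respect to `S`: the least `r` such that `g` is a product of `r`
elements of `S`. -/
noncomputable def wordLength {G : Type*} [Group G] (S : Set G) (g : G) : ℕ :=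
  sInf {r | ∃ w : List G, w.length = r ∧ (∀ x ∈ w, x ∈ S) ∧ w.prod = g}

/-- The length function of `B_n`. -/
noncomputable def lengthB {n : ℕ} (σ : B n) : ℕ := wordLength (gensB n) σ

/-- The length function of `D_n`. -/
noncomputable def lengthD {n : ℕ} (σ : D n) : ℕ := wordLength (gensD n) σ

/-- The `q`-integer `[m]_q = 1 + q + ⋯ + q^{m-1}`, with `q = X`. -/
noncomputable def qInt (m : ℕ) : ℤ[X] := ∑ k ∈ Finset.range m, Polynomial.X ^ k

end SignedPerm

/-!
A signed permutation `σ` is encoded by its window `w = (σ(1), …, σ(n))`, a word of integers. For a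
word put `invD w = #{i < j : w i > w j} + #{i < j : w i + w j < 0}` and `negs w = #{i : w i < 0}`.

*Lengths are inversion statistics.* One has `ℓ_D(σ) = invD w` (`lengthD_eq`) and
`ℓ_B(σ) = invD w + negs w` (`lengthB_eq`). Both follow from the criterion `wordLength_eq`: a
statistic that vanishes at `1`, grows by at most one under right multiplication by a generator, and
strictly drops for some generator unless the element is `1`, is the word length. Right
multiplication by `s_i` swaps two adjacent letters, which changes `invD` by exactly one
(`invD_swap`). Right multiplication by `s_0` negates the first letter; it leaves `invD` alone, since
the contribution `[b < a] + [b < -a]` of a pair `(a, b)` is even in `a`, the earlier letter. The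
additional generator of type `D` is `s_0 s_1 s_0`, so its effect follows from the other two.

*Generating function.* More generally, take words whose letters have distinct absolute values that
exhaust a set `A` of `n` positive integers. Removing the last letter `± a` leaves such a word on
`A \ {a}`, and the number of inversions lost depends only on the removed letter: it is
`#{b ∈ A : b > a}` for `a`, and `n - 1 + #{b ∈ A : b < a}` for `-a`. Induction gives
`∑ x ^ negs w * q ^ invD w = ∏_{j < n} (1 + x q ^ j) [j + 1]_q` (`sum_signedWords`), and the words
with positive last letter contribute `[n]_q` times the same product over `j < n - 1`
(`sum_signedWords_last_pos`).

At `x = q` the latter is the sum over `B_n`, as `(1 + q ^ j) [j]_q = [2j]_q`. For `D_n`, the average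
of the values of `∑ x ^ negs w * q ^ invD w` at `x = 1` and `x = -1` selects the `σ` with `neg σ`
even; the value at `x = -1` vanishes because of the factor `j = 0`, and the same factor is `2` at
`x = 1`.
-/

namespace SignedPerm

/-! ### A criterion for word length -/

/-- A statistic `L` computes the length with respect to a set `S` of involutions if it vanishes at
`1`, grows by at most one along each generator, and every `g ≠ 1` has a descent. -/
theorem wordLength_eq {G : Type*} [Group G] {S : Set G} {L : G → ℕ} (h1 : L 1 = 0)
    (hinv : ∀ x ∈ S, x * x = 1) (hle : ∀ g, ∀ x ∈ S, L (g * x) ≤ L g + 1)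
    (hdesc : ∀ g, g ≠ 1 → ∃ x ∈ S, L (g * x) < L g) (g : G) : wordLength S g = L g := by
  have lower : ∀ w : List G, (∀ x ∈ w, x ∈ S) → L w.prod ≤ w.length := by
    intro w
    induction w using List.reverseRecOn with
    | nil => intro _; simp [h1]
    | append_singleton w x ih =>
      intro h
      have h2 := ih fun y hy => h y (by simp [hy])
      have h3 := hle w.prod x (h x (by simp))
      simp only [List.prod_append, List.prod_singleton, List.length_append, List.length_singleton]
      omega
  have upper : ∀ m g, L g = m →
      ∃ w : List G, w.length ≤ m ∧ (∀ x ∈ w, x ∈ S) ∧ w.prod = g := by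
    intro m
    induction m using Nat.strong_induction_on with
    | _ m ih =>
      intro g hg
      by_cases hg1 : g = 1
      · exact ⟨[], by simp, by simp, by simp [hg1]⟩
      · obtain ⟨x, hx, hlt⟩ := hdesc g hg1
        obtain ⟨w, hw, hwS, hwp⟩ := ih _ (hg ▸ hlt) (g * x) rfl
        refine ⟨w ++ [x], ?_, ?_, ?_⟩
        · simp only [List.length_append, List.length_singleton]; omega
        · intro y hy
          rcases List.mem_append.1 hy with hy | hy
          · exact hwS y hy
          · rw [List.mem_singleton.1 hy]; exact hx
        · rw [List.prod_append, List.prod_singleton, hwp, mul_assoc, hinv x hx, mul_one]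
  obtain ⟨w, hw, hwS, hwp⟩ := upper _ g rfl
  have hw' := hwp ▸ lower w hwS
  refine le_antisymm (Nat.sInf_le ⟨w, le_antisymm hw hw', hwS, hwp⟩)
    (le_csInf ⟨_, w, rfl, hwS, hwp⟩ ?_)
  rintro r ⟨v, rfl, hvS, rfl⟩
  exact lower v hvS

/-! ### Inversions of words and their behaviour under the generators -/

/-- The contribution to `invD` of a letter `a` standing before a letter `b`: one for `a > b` and one
for `a + b < 0`. -/
def pairInv (a b : ℤ) : ℕ := (if b < a then 1 else 0) + (if b < -a then 1 else 0)

/-- The type `D` inversion number `#{i < j : w i > w j} + #{i < j : w i + w j < 0}` of a word. -/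
def invD {n : ℕ} (w : Fin n → ℤ) : ℕ := ∑ i, ∑ j, if i < j then pairInv (w i) (w j) else 0

/-- The number of negative letters of a word. -/
def negs {n : ℕ} (w : Fin n → ℤ) : ℕ := ∑ i, if w i < 0 then 1 else 0

/-- Swapping the adjacent letters `w i` and `w (i + 1)` changes `invD` by exactly one if they are
distinct; the two indicators avoid a case distinction. -/
theorem invD_swap {n i : ℕ} (w : Fin n → ℤ) (h : i + 1 < n) :
    invD (w ∘ Equiv.swap ⟨i, by omega⟩ ⟨i + 1, h⟩) +
        (if w ⟨i + 1, h⟩ < w ⟨i, by omega⟩ then 1 else 0) =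
      invD w + (if w ⟨i, by omega⟩ < w ⟨i + 1, h⟩ then 1 else 0) := by
  set k : Fin n := ⟨i, by omega⟩ with hk
  set l : Fin n := ⟨i + 1, h⟩ with hl
  have hkl : k ≠ l := by simp [hk, hl]
  have e1 : invD (w ∘ Equiv.swap k l) =
      ∑ a, ∑ b, if Equiv.swap k l a < Equiv.swap k l b then pairInv (w a) (w b) else 0 := by
    unfold invD
    rw [← Equiv.sum_comp (Equiv.swap k l)]
    refine Finset.sum_congr rfl fun a _ => ?_
    rw [← Equiv.sum_comp (Equiv.swap k l)]
    simp
  -- The swap preserves the order of every pair of positions other than `(k, l)` and `(l, k)`.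
  have e2 : ∀ a b : Fin n,
      (if Equiv.swap k l a < Equiv.swap k l b then pairInv (w a) (w b) else 0) +
        (if a = k then if b = l then pairInv (w a) (w b) else 0 else 0) =
      (if a < b then pairInv (w a) (w b) else 0) +
        (if a = l then if b = k then pairInv (w a) (w b) else 0 else 0) := by
    intro a b
    simp only [Equiv.swap_apply_def, Fin.lt_def, Fin.ext_iff, hk, hl]
    split_ifs <;> first | omega | (simp only [Fin.lt_def] at *; omega)
  have e3 := Finset.sum_congr rfl fun (a : Fin n) (_ : a ∈ Finset.univ) =>
    Finset.sum_congr rfl fun (b : Fin n) (_ : b ∈ Finset.univ) => e2 a b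
  have d1 : ∀ u v : Fin n, (∑ a, ∑ b, if a = u then if b = v then pairInv (w a) (w b) else 0 else 0)
      = pairInv (w u) (w v) := by
    intro u v
    rw [Finset.sum_eq_single u, Finset.sum_eq_single v] <;> simp +contextual
  simp only [Finset.sum_add_distrib] at e3
  rw [d1, d1, ← e1] at e3
  change _ = invD w + _ at e3
  simp only [pairInv] at e3
  split_ifs at e3 ⊢ <;> omega

theorem negs_comp_perm {n : ℕ} (w : Fin n → ℤ) (e : Equiv.Perm (Fin n)) :
    negs (w ∘ e) = negs w :=
  Equiv.sum_comp e fun i => if w i < 0 then 1 else 0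

/-- The word with its first letter negated. -/
def negFirst {n : ℕ} (w : Fin n → ℤ) : Fin n → ℤ := fun i => if (i : ℕ) = 0 then -w i else w i

/-- The first letter occurs in pairs only as the earlier letter, and `pairInv` is even in it. -/
theorem invD_negFirst {n : ℕ} (w : Fin n → ℤ) : invD (negFirst w) = invD w := by
  refine Finset.sum_congr rfl fun i _ => Finset.sum_congr rfl fun j _ => ?_
  split_ifs with hij
  · have hj : (j : ℕ) ≠ 0 := by have := Fin.lt_def.1 hij; omega
    by_cases hi : (i : ℕ) = 0
    · simp only [negFirst, hi, hj, if_true, if_false, pairInv, neg_neg]; omega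
    · simp [negFirst, hi, hj]
  · rfl

theorem negs_negFirst {n : ℕ} (w : Fin n → ℤ) (h : 0 < n) :
    negs (negFirst w) + (if w ⟨0, h⟩ < 0 then 1 else 0) =
      negs w + (if 0 < w ⟨0, h⟩ then 1 else 0) := by
  obtain ⟨m, rfl⟩ := Nat.exists_eq_succ_of_ne_zero h.ne'
  have h0 : negFirst w 0 = -w 0 := if_pos rfl
  have hs : ∀ i : Fin m, negFirst w i.succ = w i.succ := fun i => if_neg (by simp)
  have e : negs (negFirst w) = (if -w 0 < 0 then 1 else 0) + negs fun i : Fin m => w i.succ := by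
    rw [negs, Fin.sum_univ_succ, h0]
    simp only [hs, negs]
  have e' : negs w = (if w 0 < 0 then 1 else 0) + negs fun i : Fin m => w i.succ :=
    Fin.sum_univ_succ _
  change negs (negFirst w) + (if w 0 < 0 then 1 else 0) = negs w + (if 0 < w 0 then 1 else 0)
  rw [e, e']
  split_ifs <;> omega

/-- An increasing word of `n` integers in `[1, n]` is `1, 2, …, n`. -/
theorem eq_succ_of_increasing {n : ℕ} (w : Fin n → ℤ) (hpos : ∀ i, 1 ≤ w i) (hle : ∀ i, w i ≤ n)
    (hlt : ∀ (i : ℕ) (h : i + 1 < n), w ⟨i, by omega⟩ < w ⟨i + 1, h⟩) (i : Fin n) :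
    w i = i + 1 := by
  have lo : ∀ (i : ℕ) (h : i < n), (i : ℤ) + 1 ≤ w ⟨i, h⟩ := by
    intro i
    induction i with
    | zero => intro h; simpa using hpos ⟨0, h⟩
    | succ i ih => intro h; have := ih (by omega); have := hlt i h; push_cast; omega
  have hi : ∀ (d i : ℕ) (h : i < n), i + 1 + d = n → w ⟨i, h⟩ ≤ i + 1 := by
    intro d
    induction d with
    | zero => intro i h hd; have := hle ⟨i, h⟩; omega
    | succ d ih =>
      intro i h hd
      have h1 := ih (i + 1) (by omega) (by omega)
      have := hlt i (by omega)
      push_cast at h1; omega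
  exact le_antisymm (hi (n - 1 - i) i i.2 (by omega)) (lo i i.2)

/-! ### Windows of signed permutations -/

/-- The window `(σ(1), …, σ(n))` as a word; positions are indexed from `0`, so letter `i` is
`σ(i + 1)`. -/
def window {n : ℕ} (σ : B n) (i : Fin n) : ℤ := val σ (pt (i + 1) (by omega) i.2)

theorem val_mul {n : ℕ} (σ τ : B n) (a : PM n) : val (σ * τ) a = val σ (val τ a) := rfl

theorem val_pt {n : ℕ} (σ : B n) {i : ℕ} (h1 : 1 ≤ i) (h2 : i ≤ n) :
    (val σ (pt i h1 h2) : ℤ) = window σ ⟨i - 1, by omega⟩ := by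
  simp only [window, Nat.sub_add_cancel h1]

theorem eq_pt {n : ℕ} (a : PM n) (h : 0 < (a : ℤ)) :
    a = pt (a : ℤ).natAbs (by omega) (by have := a.2; omega) := by
  apply Subtype.ext; rw [coe_pt]; omega

theorem neg_eq_pt {n : ℕ} (a : PM n) (h : (a : ℤ) < 0) :
    a = -pt (a : ℤ).natAbs (by omega) (by have := a.2; omega) := by
  apply Subtype.ext; rw [coe_neg, coe_pt]; omega

theorem window_injective (n : ℕ) : Function.Injective (window (n := n)) := by
  intro σ τ h
  have hp : ∀ i h1 h2, val σ (pt i h1 h2) = val τ (pt i h1 h2) := fun i h1 h2 =>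
    Subtype.ext (by rw [val_pt, val_pt, h])
  refine Subtype.ext (Equiv.ext fun a => ?_)
  change val σ a = val τ a
  rcases lt_or_gt_of_ne a.2.1 with ha | ha
  · rw [neg_eq_pt a ha, val_neg, val_neg, hp]
  · rw [eq_pt a ha, hp]

theorem window_one {n : ℕ} (i : Fin n) : window 1 i = i + 1 := by
  change ((pt (i + 1) (by omega) i.2 : PM n) : ℤ) = _
  simp

theorem natAbs_window {n : ℕ} (σ : B n) (i : Fin n) : (window σ i).natAbs ∈ Finset.Icc 1 n := by
  have := (val σ (pt (i + 1) (by omega) i.2)).2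
  rw [Finset.mem_Icc]; unfold window; omega

theorem natAbs_window_injective {n : ℕ} (σ : B n) :
    Function.Injective fun i => (window σ i).natAbs := by
  intro i j h
  have hinj : Function.Injective (val σ) := (σ : Equiv.Perm (PM n)).injective
  rcases Int.natAbs_eq_natAbs_iff.1 h with h | h
  · have := congrArg Subtype.val (hinj (Subtype.ext h))
    simp only [coe_pt] at this; omega
  · unfold window at h
    rw [← coe_neg, ← val_neg] at h
    have := congrArg Subtype.val (hinj (Subtype.ext h))
    simp only [coe_neg, coe_pt] at this; omega

theorem neg_eq_negs {n : ℕ} (σ : B n) : neg σ = negs (window σ) := by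
  unfold neg negs
  rw [Finset.sum_boole, Nat.cast_id]
  symm
  refine Finset.card_nbij (fun i => pt (i + 1) (by omega) i.2) ?_ ?_ ?_
  · intro i hi
    exact Finset.mem_filter.2 ⟨Finset.mem_univ _, by rw [coe_pt]; omega, (Finset.mem_filter.1 hi).2⟩
  · intro i _ j _ h
    have := congrArg Subtype.val h
    simp only [coe_pt] at this; omega
  · intro a ha
    simp only [Finset.coe_filter, Finset.mem_univ, true_and, Set.mem_ofPred_eq] at ha
    rw [eq_pt a ha.1, val_pt] at ha
    have := a.2
    refine ⟨⟨(a : ℤ).natAbs - 1, by omega⟩, by simpa using ha.2, Subtype.ext ?_⟩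
    simp only [coe_pt]; omega

theorem window_mul_s {n i : ℕ} (σ : B n) (h : i + 1 < n) :
    window (σ * s (i + 1) (by omega) h) =
      window σ ∘ Equiv.swap ⟨i, by omega⟩ ⟨i + 1, h⟩ := by
  funext j
  simp only [window, val_mul, Function.comp_apply]
  congr 2
  apply Subtype.ext
  simp only [val, s, Equiv.Perm.mul_apply, Equiv.swap_apply_def, Subtype.ext_iff, coe_neg,
    coe_pt, Fin.ext_iff]
  split_ifs <;> (try simp only [coe_neg, coe_pt] at *) <;> omega

theorem window_mul_s0 {n : ℕ} (σ : B n) (h : 1 ≤ n) :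
    window (σ * s0 h) = negFirst (window σ) := by
  funext j
  have : val (s0 h) (pt (j + 1) (by omega) j.2) =
      if (j : ℕ) = 0 then -pt (j + 1) (by omega) j.2 else pt (j + 1) (by omega) j.2 := by
    apply Subtype.ext
    simp only [val, s0, Equiv.swap_apply_def, Subtype.ext_iff, coe_neg, coe_pt]
    split_ifs <;> (try simp only [coe_neg, coe_pt] at *) <;> omega
  simp only [window, val_mul, this, negFirst]
  split_ifs
  · rw [val_neg, coe_neg]
  · rfl

/-! ### The length functions -/

theorem s0D_eq {n : ℕ} (h : 2 ≤ n) : s0D h = s0 (by omega) * s 1 le_rfl h * s0 (by omega) := by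
  apply window_injective
  rw [window_mul_s0, window_mul_s (i := 0)]
  funext j
  have hs : ∀ i : Fin n, window (s0 (by omega)) i = if (i : ℕ) = 0 then -(i + 1 : ℤ) else i + 1 := by
    intro i
    have := congrFun (window_mul_s0 (1 : B n) (show 1 ≤ n by omega)) i
    rw [one_mul] at this
    rw [this, negFirst, window_one]
  simp only [negFirst, Function.comp_apply, hs]
  simp only [window, val, s0D, Equiv.Perm.mul_apply, Equiv.swap_apply_def, Subtype.ext_iff,
    coe_neg, coe_pt, Fin.ext_iff]
  split_ifs <;> (try simp only [coe_neg, coe_pt] at *) <;> first | omega | tauto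

theorem s0_mul_self {n : ℕ} (h : 1 ≤ n) : (s0 h * s0 h : B n) = 1 := by
  apply window_injective
  rw [window_mul_s0]
  have := window_mul_s0 (1 : B n) h
  rw [one_mul] at this
  rw [this]
  funext j
  simp only [negFirst]
  split_ifs <;> simp

theorem s_mul_self {n i : ℕ} (h1 : 1 ≤ i) (h2 : i < n) : (s i h1 h2 * s i h1 h2 : B n) = 1 := by
  obtain ⟨i, rfl⟩ := Nat.exists_eq_succ_of_ne_zero (by omega : i ≠ 0)
  apply window_injective
  rw [window_mul_s]
  have := window_mul_s (1 : B n) h2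
  rw [one_mul] at this
  rw [this]
  funext j
  simp

theorem s0D_mul_self {n : ℕ} (h : 2 ≤ n) : (s0D h * s0D h : B n) = 1 := by
  rw [s0D_eq]
  calc _ = s0 (by omega) * (s 1 le_rfl h * (s0 (by omega) * s0 (by omega)) * s 1 le_rfl h) *
        s0 (by omega) := by group
    _ = 1 := by rw [s0_mul_self, mul_one, s_mul_self, mul_one, s0_mul_self]

theorem invD_window_mul_s0 {n : ℕ} (σ : B n) (h : 1 ≤ n) :
    invD (window (σ * s0 h)) = invD (window σ) := by rw [window_mul_s0, invD_negFirst]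

/-- As `s0D = s_0 s_1 s_0`, this is the case of `s_1` applied to the window with its first letter
negated. -/
theorem invD_window_mul_s0D {n : ℕ} (σ : B n) (h : 2 ≤ n) :
    invD (window (σ * s0D h)) + (if window σ ⟨1, h⟩ < -window σ ⟨0, by omega⟩ then 1 else 0) =
      invD (window σ) + (if -window σ ⟨0, by omega⟩ < window σ ⟨1, h⟩ then 1 else 0) := by
  have := invD_swap (i := 0) (window (σ * s0 (by omega))) h
  rw [invD_window_mul_s0, window_mul_s0] at this
  rw [s0D_eq, ← mul_assoc, invD_window_mul_s0, ← mul_assoc, window_mul_s, window_mul_s0]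
  simpa [negFirst] using this

theorem eq_one_of_window {n : ℕ} (σ : B n) (hpos : ∀ i, 0 < window σ i)
    (hlt : ∀ (i : ℕ) (h : i + 1 < n), window σ ⟨i, by omega⟩ < window σ ⟨i + 1, h⟩) : σ = 1 := by
  apply window_injective
  funext i
  rw [window_one]
  refine eq_succ_of_increasing _ hpos (fun i => ?_) hlt i
  have := Finset.mem_Icc.1 (natAbs_window σ i); omega

theorem window_adjacent_ne {n i : ℕ} (σ : B n) (h : i + 1 < n) :
    (window σ ⟨i, by omega⟩).natAbs ≠ (window σ ⟨i + 1, h⟩).natAbs := by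
  intro he
  have := natAbs_window_injective σ he
  simp at this

theorem invD_window_one (n : ℕ) : invD (window (1 : B n)) = 0 := by
  refine Finset.sum_eq_zero fun i _ => Finset.sum_eq_zero fun j _ => ?_
  simp only [window_one, pairInv, Fin.lt_def]
  split_ifs <;> omega

theorem negs_window_one (n : ℕ) : negs (window (1 : B n)) = 0 := by
  refine Finset.sum_eq_zero fun i _ => ?_
  rw [window_one, if_neg (by omega)]

theorem lengthB_eq {n : ℕ} (σ : B n) :
    lengthB σ = invD (window σ) + negs (window σ) := by
  refine wordLength_eq (L := fun σ : B n => invD (window σ) + negs (window σ)) ?_ ?_ ?_ ?_ σ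
  · simp only [invD_window_one, negs_window_one]
  · rintro x (⟨h, rfl⟩ | ⟨i, h1, h2, rfl⟩)
    · exact s0_mul_self h
    · exact s_mul_self h1 h2
  · rintro g x (⟨h, rfl⟩ | ⟨i, h1, h2, rfl⟩)
    · have := negs_negFirst (window g) h
      simp only [window_mul_s0, invD_negFirst]
      split_ifs at this <;> omega
    · obtain ⟨i, rfl⟩ := Nat.exists_eq_succ_of_ne_zero (by omega : i ≠ 0)
      have := invD_swap (window g) h2
      simp only [Nat.succ_eq_add_one, window_mul_s, negs_comp_perm]
      split_ifs at this <;> omega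
  -- Without a descent, the first letter is positive and the window is increasing.
  · intro g hg
    by_contra! hcon
    have h0 : ∀ h : 0 < n, 0 < window g ⟨0, h⟩ := by
      intro h
      have h3 := negs_negFirst (window g) h
      have h4 := hcon _ (Or.inl ⟨h, rfl⟩)
      have h5 := Finset.mem_Icc.1 (natAbs_window g ⟨0, h⟩)
      simp only [window_mul_s0, invD_negFirst] at h4
      split_ifs at h3 <;> omega
    have h1 : ∀ (i : ℕ) (h : i + 1 < n), window g ⟨i, by omega⟩ < window g ⟨i + 1, h⟩ := by
      intro i h
      have h3 := invD_swap (window g) h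
      have h4 := hcon _ (Or.inr ⟨i + 1, by omega, h, rfl⟩)
      have h5 := window_adjacent_ne g h
      simp only [window_mul_s, negs_comp_perm] at h4
      split_ifs at h3 <;> omega
    refine hg (eq_one_of_window g (fun i => ?_) h1)
    obtain ⟨i, hi⟩ := i
    induction i with
    | zero => exact h0 hi
    | succ i ih => exact (ih (by omega)).trans (h1 i hi)

theorem lengthD_eq {n : ℕ} (σ : D n) : lengthD σ = invD (window (σ : B n)) := by
  refine wordLength_eq (L := fun σ : D n => invD (window (σ : B n))) (invD_window_one n) ?_ ?_ ?_ σ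
  · rintro x (⟨h, rfl⟩ | ⟨i, h1, h2, rfl⟩)
    · exact Subtype.ext (s0D_mul_self h)
    · exact Subtype.ext (s_mul_self h1 h2)
  · rintro g x (⟨h, rfl⟩ | ⟨i, h1, h2, rfl⟩)
    · have := invD_window_mul_s0D (g : B n) h
      simp only [Subgroup.coe_mul]
      split_ifs at this <;> omega
    · obtain ⟨i, rfl⟩ := Nat.exists_eq_succ_of_ne_zero (by omega : i ≠ 0)
      have := invD_swap (window (g : B n)) h2
      simp only [Subgroup.coe_mul, Nat.succ_eq_add_one, window_mul_s]
      split_ifs at this <;> omega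
  -- Without a descent, the window is increasing and its second letter exceeds both the first letter
  -- and its negative, so all letters but possibly the first are positive.
  · intro g hg
    by_contra! hcon
    have h0 : ∀ h : 1 < n, -window (g : B n) ⟨0, by omega⟩ < window (g : B n) ⟨1, h⟩ := by
      intro h
      have h3 := invD_window_mul_s0D (g : B n) h
      have h4 := hcon _ (Or.inl ⟨h, rfl⟩)
      have h5 := window_adjacent_ne (i := 0) (g : B n) h
      simp only [Subgroup.coe_mul] at h4
      simp only [zero_add] at h5
      split_ifs at h3 <;> omega
    have h1 : ∀ (i : ℕ) (h : i + 1 < n),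
        window (g : B n) ⟨i, by omega⟩ < window (g : B n) ⟨i + 1, h⟩ := by
      intro i h
      have h3 := invD_swap (window (g : B n)) h
      have h4 := hcon _ (Or.inr ⟨i + 1, by omega, h, rfl⟩)
      have h5 := window_adjacent_ne (g : B n) h
      simp only [Subgroup.coe_mul, window_mul_s] at h4
      split_ifs at h3 <;> omega
    have h2 : ∀ (i : ℕ) (h : i + 1 < n), 0 < window (g : B n) ⟨i + 1, h⟩ := by
      intro i
      induction i with
      | zero => intro h; have := h0 h; have := h1 0 h; simp only [zero_add] at *; omega
      | succ i ih => intro h; exact (ih (by omega)).trans (h1 (i + 1) h)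
    have h3 : ∀ i : Fin n, 0 < window (g : B n) i := by
      rintro ⟨i, hi⟩
      cases i with
      | succ i => exact h2 i hi
      | zero =>
        -- A negative first letter would be the only one, against the parity condition of `D n`.
        by_contra hneg
        have hne := Finset.mem_Icc.1 (natAbs_window (g : B n) ⟨0, hi⟩)
        have : neg (g : B n) = 1 := by
          rw [neg_eq_negs, negs, Finset.sum_eq_single ⟨0, hi⟩]
          · rw [if_pos (by omega)]
          · rintro ⟨j, hj⟩ - hj0
            cases j with
            | zero => exact absurd rfl hj0
            | succ j => rw [if_neg (h2 j hj).not_gt]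
          · simp
        have hev := mem_D.1 g.2
        rw [this] at hev
        exact Nat.not_even_one hev
    exact hg (Subtype.ext (eq_one_of_window _ h3 h1))

/-! ### Words in signed letters -/

/-- The letters `± a` with `a ∈ A`. -/
def signedLetters (A : Finset ℕ) : Finset ℤ :=
  A.image (fun a : ℕ => (a : ℤ)) ∪ A.image fun a : ℕ => -(a : ℤ)

theorem mem_signedLetters {A : Finset ℕ} {k : ℤ} : k ∈ signedLetters A ↔ k.natAbs ∈ A := by
  simp only [signedLetters, Finset.mem_union, Finset.mem_image]
  constructor
  · rintro (⟨a, ha, rfl⟩ | ⟨a, ha, rfl⟩) <;> simpa using ha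
  · intro h
    rcases Int.natAbs_eq k with hk | hk
    · exact Or.inl ⟨_, h, hk.symm⟩
    · exact Or.inr ⟨_, h, hk.symm⟩

theorem sum_signedLetters {M : Type*} [AddCommMonoid M] {A : Finset ℕ} (h0 : 0 ∉ A) (f : ℤ → M) :
    ∑ k ∈ signedLetters A, f k = ∑ a ∈ A, f a + ∑ a ∈ A, f (-a) := by
  rw [signedLetters, Finset.sum_union, Finset.sum_image, Finset.sum_image]
  · intro a _ b _ h; simpa using h
  · intro a _ b _ h; simpa using h
  · rw [Finset.disjoint_left]
    intro k hk hk'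
    obtain ⟨a, ha, rfl⟩ := Finset.mem_image.1 hk
    obtain ⟨b, hb, hab⟩ := Finset.mem_image.1 hk'
    have : a ≠ 0 := fun h => h0 (h ▸ ha)
    omega

open Classical in
/-- The words of length `n` in the letters `± a`, `a ∈ A`, with distinct absolute values. They are
used for `A` of cardinality `n`, where each absolute value occurs exactly once. -/
noncomputable def signedWords (A : Finset ℕ) (n : ℕ) : Finset (Fin n → ℤ) :=
  (Fintype.piFinset fun _ => signedLetters A).filter
    fun w => Function.Injective fun i => (w i).natAbs

theorem mem_signedWords {A : Finset ℕ} {n : ℕ} {w : Fin n → ℤ} :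
    w ∈ signedWords A n ↔
      (∀ i, (w i).natAbs ∈ A) ∧ Function.Injective fun i => (w i).natAbs := by
  simp [signedWords, mem_signedLetters]

/-- Summation over words of length `n + 1` by splitting off the last letter. -/
theorem sum_signedWords_succ {M : Type*} [AddCommMonoid M] (A : Finset ℕ) (n : ℕ)
    (F : (Fin (n + 1) → ℤ) → M) :
    ∑ w ∈ signedWords A (n + 1), F w =
      ∑ k ∈ signedLetters A, ∑ v ∈ signedWords (A.erase k.natAbs) n,
        F (Fin.snoc (α := fun _ => ℤ) v k) := by
  rw [Finset.sum_sigma']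
  refine Finset.sum_nbij' (fun w => ⟨w (Fin.last n), Fin.init (α := fun _ => ℤ) w⟩)
    (fun p => Fin.snoc (α := fun _ => ℤ) p.2 p.1) ?_ ?_ ?_ ?_ ?_
  · intro w hw
    obtain ⟨h1, h2⟩ := mem_signedWords.1 hw
    refine Finset.mem_sigma.2 ⟨mem_signedLetters.2 (h1 _), mem_signedWords.2 ⟨fun i => ?_, ?_⟩⟩
    · exact Finset.mem_erase.2 ⟨fun h => (Fin.castSucc_lt_last i).ne (h2 h), h1 _⟩
    · exact h2.comp (Fin.castSucc_injective n)
  · rintro ⟨k, v⟩ hp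
    obtain ⟨hk, hv⟩ := Finset.mem_sigma.1 hp
    obtain ⟨h1, h2⟩ := mem_signedWords.1 hv
    refine mem_signedWords.2 ⟨fun i => ?_, fun i j hij => ?_⟩
    · induction i using Fin.lastCases with
      | last => simpa using mem_signedLetters.1 hk
      | cast i => simpa using Finset.mem_of_mem_erase (h1 i)
    · induction i using Fin.lastCases with
      | last =>
        induction j using Fin.lastCases with
        | last => rfl
        | cast j =>
          simp only [Fin.snoc_last, Fin.snoc_castSucc] at hij
          exact absurd hij.symm (Finset.ne_of_mem_erase (h1 j))
      | cast i =>
        induction j using Fin.lastCases with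
        | last =>
          simp only [Fin.snoc_last, Fin.snoc_castSucc] at hij
          exact absurd hij (Finset.ne_of_mem_erase (h1 i))
        | cast j =>
          simp only [Fin.snoc_castSucc] at hij
          rw [h2 hij]
  · intro w _; exact Fin.snoc_init_self w
  · rintro ⟨k, v⟩ _; simp
  · intro w _; simp

theorem negs_snoc {n : ℕ} (v : Fin n → ℤ) (k : ℤ) :
    negs (Fin.snoc (α := fun _ => ℤ) v k : Fin (n + 1) → ℤ) = negs v + if k < 0 then 1 else 0 := by
  rw [negs, Fin.sum_univ_castSucc]
  simp only [Fin.snoc_castSucc, Fin.snoc_last, negs]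

theorem invD_snoc {n : ℕ} (v : Fin n → ℤ) (k : ℤ) :
    invD (Fin.snoc (α := fun _ => ℤ) v k : Fin (n + 1) → ℤ) = invD v + ∑ i, pairInv (v i) k := by
  simp [invD, Fin.sum_univ_castSucc, Finset.sum_add_distrib, Fin.castSucc_lt_last,
    (Fin.castSucc_lt_last _).not_gt]

/-- The pairs formed with a last letter `k` contribute an amount independent of the order and of the
signs of the letters before it. -/
theorem sum_pairInv {n : ℕ} {C : Finset ℕ} (hC : C.card = n) {v : Fin n → ℤ}
    (hv : v ∈ signedWords C n) (k : ℤ) :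
    ∑ i, pairInv (v i) k = ∑ b ∈ C, pairInv b k := by
  obtain ⟨h1, h2⟩ := mem_signedWords.1 hv
  have himg : Finset.univ.image (fun i => (v i).natAbs) = C := by
    refine Finset.eq_of_subset_of_card_le (fun b hb => ?_) ?_
    · obtain ⟨i, -, rfl⟩ := Finset.mem_image.1 hb
      exact h1 i
    · rw [Finset.card_image_of_injective _ h2, hC, Finset.card_fin]
  rw [← himg, Finset.sum_image fun i _ j _ h => h2 h]
  refine Finset.sum_congr rfl fun i _ => ?_
  unfold pairInv
  rcases Int.natAbs_eq (v i) with h | h <;> split_ifs <;> omega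

theorem sum_pairInv_pos {A : Finset ℕ} (a : ℕ) :
    ∑ b ∈ A.erase a, pairInv b a = (A.filter (a < ·)).card := by
  rw [Finset.card_filter, ← Finset.sum_erase A (a := a) (by simp)]
  refine Finset.sum_congr rfl fun b _ => ?_
  unfold pairInv
  split_ifs <;> omega

theorem sum_pairInv_neg {A : Finset ℕ} (h0 : 0 ∉ A) {a : ℕ} (ha : a ∈ A) :
    ∑ b ∈ A.erase a, pairInv b (-a) = (A.erase a).card + (A.filter (· < a)).card := by
  rw [Finset.card_filter, ← Finset.sum_erase A (a := a) (by simp), Finset.card_eq_sum_ones,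
    ← Finset.sum_add_distrib]
  refine Finset.sum_congr rfl fun b _ => ?_
  have : a ≠ 0 := fun h => h0 (h ▸ ha)
  unfold pairInv
  split_ifs <;> omega

/-! ### The generating function of signed words -/

section generating

variable {R : Type*} [CommSemiring R]

theorem sum_pow_card_gt (q : R) (A : Finset ℕ) :
    ∑ a ∈ A, q ^ (A.filter (a < ·)).card = ∑ k ∈ Finset.range A.card, q ^ k := by
  induction A using Finset.induction_on_min with
  | empty => simp
  | insert a A ha ih =>
    have hna : a ∉ A := fun h => (ha a h).false
    rw [Finset.sum_insert hna, Finset.card_insert_of_notMem hna, Finset.sum_range_succ, ← ih,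
      add_comm]
    congr 1
    · refine Finset.sum_congr rfl fun b hb => ?_
      rw [Finset.filter_insert, if_neg (ha b hb).not_gt]
    · rw [Finset.filter_insert, if_neg (lt_irrefl a), Finset.filter_true_of_mem ha]

theorem sum_pow_card_lt (q : R) (A : Finset ℕ) :
    ∑ a ∈ A, q ^ (A.filter (· < a)).card = ∑ k ∈ Finset.range A.card, q ^ k := by
  induction A using Finset.induction_on_max with
  | empty => simp
  | insert a A ha ih =>
    have hna : a ∉ A := fun h => (ha a h).false
    rw [Finset.sum_insert hna, Finset.card_insert_of_notMem hna, Finset.sum_range_succ, ← ih,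
      add_comm]
    congr 1
    · refine Finset.sum_congr rfl fun b hb => ?_
      rw [Finset.filter_insert, if_neg (ha b hb).not_gt]
    · rw [Finset.filter_insert, if_neg (lt_irrefl a), Finset.filter_true_of_mem ha]

theorem sum_snoc_pos (x q : R) {A : Finset ℕ} {n : ℕ} (hA : A.card = n + 1) {a : ℕ} (ha : a ∈ A) :
    ∑ v ∈ signedWords (A.erase a) n, x ^ negs (Fin.snoc (α := fun _ => ℤ) v (a : ℤ)) *
        q ^ invD (Fin.snoc (α := fun _ => ℤ) v (a : ℤ)) =
      q ^ (A.filter (a < ·)).card * ∑ v ∈ signedWords (A.erase a) n, x ^ negs v * q ^ invD v := by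
  rw [Finset.mul_sum]
  refine Finset.sum_congr rfl fun v hv => ?_
  rw [negs_snoc, invD_snoc, sum_pairInv (by rw [Finset.card_erase_of_mem ha, hA]; rfl) hv,
    sum_pairInv_pos, if_neg (by omega), pow_add]
  ring

theorem sum_snoc_neg (x q : R) {A : Finset ℕ} (h0 : 0 ∉ A) {n : ℕ} (hA : A.card = n + 1) {a : ℕ}
    (ha : a ∈ A) :
    ∑ v ∈ signedWords (A.erase a) n, x ^ negs (Fin.snoc (α := fun _ => ℤ) v (-a : ℤ)) *
        q ^ invD (Fin.snoc (α := fun _ => ℤ) v (-a : ℤ)) =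
      x * q ^ n * q ^ (A.filter (· < a)).card *
        ∑ v ∈ signedWords (A.erase a) n, x ^ negs v * q ^ invD v := by
  have hc : (A.erase a).card = n := by rw [Finset.card_erase_of_mem ha, hA]; rfl
  have : a ≠ 0 := fun h => h0 (h ▸ ha)
  rw [Finset.mul_sum]
  refine Finset.sum_congr rfl fun v hv => ?_
  rw [negs_snoc, invD_snoc, sum_pairInv hc hv, sum_pairInv_neg h0 ha, hc, if_pos (by omega)]
  ring

theorem sum_signedWords (x q : R) (n : ℕ) (A : Finset ℕ) (hA : A.card = n) (h0 : 0 ∉ A) :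
    ∑ w ∈ signedWords A n, x ^ negs w * q ^ invD w =
      ∏ j ∈ Finset.range n, ((1 + x * q ^ j) * ∑ k ∈ Finset.range (j + 1), q ^ k) := by
  induction n generalizing A with
  | zero =>
    have : signedWords A 0 = Finset.univ :=
      Finset.eq_univ_iff_forall.2 fun w =>
        mem_signedWords.2 ⟨fun i => i.elim0, fun i => i.elim0⟩
    rw [this]
    simp [negs, invD]
  | succ n ih =>
    have ih' : ∀ a ∈ A, ∑ v ∈ signedWords (A.erase a) n, x ^ negs v * q ^ invD v =
        ∏ j ∈ Finset.range n, ((1 + x * q ^ j) * ∑ k ∈ Finset.range (j + 1), q ^ k) :=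
      fun a ha => ih _ (by rw [Finset.card_erase_of_mem ha, hA]; rfl)
        fun h => h0 (Finset.mem_of_mem_erase h)
    rw [sum_signedWords_succ, sum_signedLetters h0, Finset.prod_range_succ]
    simp only [Int.natAbs_neg, Int.natAbs_natCast]
    rw [Finset.sum_congr rfl fun a ha => (sum_snoc_pos x q hA ha).trans (by rw [ih' a ha]),
      Finset.sum_congr rfl fun a ha => (sum_snoc_neg x q h0 hA ha).trans (by rw [ih' a ha]),
      ← Finset.sum_mul, ← Finset.sum_mul, ← Finset.mul_sum, sum_pow_card_gt, sum_pow_card_lt, hA]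
    ring

theorem sum_signedWords_last_pos (x q : R) (n : ℕ) (A : Finset ℕ) (hA : A.card = n + 1)
    (h0 : 0 ∉ A) :
    (∑ w ∈ signedWords A (n + 1), if 0 < w (Fin.last n) then x ^ negs w * q ^ invD w else 0) =
      (∑ k ∈ Finset.range (n + 1), q ^ k) *
        ∏ j ∈ Finset.range n, ((1 + x * q ^ j) * ∑ k ∈ Finset.range (j + 1), q ^ k) := by
  have hpos : ∀ a ∈ A, 0 < a := fun a ha => Nat.pos_of_ne_zero fun h => h0 (h ▸ ha)
  rw [sum_signedWords_succ, sum_signedLetters h0]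
  simp only [Int.natAbs_neg, Int.natAbs_natCast, Fin.snoc_last]
  have hneg : ∀ a : ℕ, ¬ (0 : ℤ) < -a := fun a => by omega
  simp only [hneg, if_false, Finset.sum_const_zero, add_zero]
  have hq := sum_pow_card_gt q A
  rw [hA] at hq
  rw [← hq, Finset.sum_mul]
  refine Finset.sum_congr rfl fun a ha => ?_
  simp only [Int.natCast_pos, hpos a ha, if_true]
  rw [sum_snoc_pos x q hA ha, sum_signedWords x q n _ (by rw [Finset.card_erase_of_mem ha, hA]; rfl)
    fun h => h0 (Finset.mem_of_mem_erase h)]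

end generating

/-! ### Summation over the groups -/

theorem exists_window_eq {n : ℕ} {w : Fin n → ℤ} (hw : w ∈ signedWords (Finset.Icc 1 n) n) :
    ∃ σ : B n, window σ = w := by
  obtain ⟨h1, h2⟩ := mem_signedWords.1 hw
  simp only [Finset.mem_Icc] at h1
  let idx : PM n → Fin n := fun a => ⟨(a : ℤ).natAbs - 1, by have := a.2; omega⟩
  let f : PM n → PM n := fun a =>
    ⟨if 0 < (a : ℤ) then w (idx a) else -w (idx a), by have := h1 (idx a); split_ifs <;> omega⟩
  have hf : ∀ a, (f a : ℤ) = if 0 < (a : ℤ) then w (idx a) else -w (idx a) := fun _ => rfl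
  have hinj : Function.Injective f := by
    intro a b hab
    have hab' := congrArg Subtype.val hab
    rw [hf, hf] at hab'
    have hidx : idx a = idx b := h2 (by dsimp only; split_ifs at hab' <;> omega)
    have hab2 : (a : ℤ).natAbs - 1 = (b : ℤ).natAbs - 1 := congrArg Fin.val hidx
    have ha := a.2
    have hb := b.2
    have := h1 (idx b)
    rw [hidx] at hab'
    apply Subtype.ext
    split_ifs at hab' <;> omega
  refine ⟨⟨Equiv.ofBijective f (Finite.injective_iff_bijective.1 hinj), mem_B.2 fun a => ?_⟩, ?_⟩
  · have hidx : idx (-a) = idx a := Fin.ext (by simp [idx])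
    have ha := a.2
    apply Subtype.ext
    simp only [Equiv.ofBijective_apply, coe_neg, hf, hidx]
    split_ifs <;> omega
  · funext i
    change (f (pt (i + 1) (by omega) i.2) : ℤ) = w i
    rw [hf, if_pos (by rw [coe_pt]; omega)]
    congr 1

theorem sum_B_eq_sum_signedWords {M : Type*} [AddCommMonoid M] (n : ℕ) (F : (Fin n → ℤ) → M) :
    ∑ σ : B n, F (window σ) = ∑ w ∈ signedWords (Finset.Icc 1 n) n, F w := by
  refine Finset.sum_nbij window ?_ ?_ ?_ fun _ _ => rfl
  · exact fun σ _ => mem_signedWords.2 ⟨natAbs_window σ, natAbs_window_injective σ⟩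
  · exact (window_injective n).injOn
  · intro w hw
    obtain ⟨σ, rfl⟩ := exists_window_eq hw
    exact ⟨σ, by simp, rfl⟩

open Polynomial in
theorem qInt_two_mul (m : ℕ) : qInt (2 * m) = (1 + X ^ m) * qInt m := by
  rw [qInt, two_mul, Finset.sum_range_add, qInt, add_mul, one_mul, Finset.mul_sum]
  simp only [pow_add]

open Polynomial in
theorem prod_qInt_two_mul (m : ℕ) :
    ∏ j ∈ Finset.Icc 1 m, qInt (2 * j) =
      ∏ j ∈ Finset.range m, ((1 + X * X ^ j) * qInt (j + 1)) := by
  induction m with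
  | zero => simp
  | succ m ih =>
    rw [Finset.prod_Icc_succ_top (by omega), ih, Finset.prod_range_succ, qInt_two_mul, pow_succ' X m]

open Polynomial in
theorem sum_lengthB (m : ℕ) :
    ∑ σ : B (m + 1) with 0 < (val σ (pt (m + 1) (by omega) le_rfl) : ℤ), (X : ℤ[X]) ^ lengthB σ =
      qInt (m + 1) * ∏ j ∈ Finset.Icc 1 m, qInt (2 * j) := by
  rw [prod_qInt_two_mul, Finset.sum_filter]
  have := sum_signedWords_last_pos (X : ℤ[X]) X m (Finset.Icc 1 (m + 1)) (by simp) (by simp)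
  rw [← sum_B_eq_sum_signedWords (m + 1) fun w =>
    if 0 < w (Fin.last m) then (X : ℤ[X]) ^ negs w * X ^ invD w else 0] at this
  refine Eq.trans (Finset.sum_congr rfl fun σ _ => ?_) this
  rw [lengthB_eq, pow_add, mul_comm]
  rfl

open Polynomial in
theorem sum_lengthD (m : ℕ) :
    ∑ σ : D (m + 1), (X : ℤ[X]) ^ lengthD σ =
      qInt (m + 1) * ∏ j ∈ Finset.Icc 1 m, qInt (2 * j) := by
  have hsum : ∀ x : ℤ[X], ∑ σ : B (m + 1), x ^ neg σ * X ^ invD (window σ) =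
      ∏ j ∈ Finset.range (m + 1), ((1 + x * X ^ j) * qInt (j + 1)) := fun x => by
    simp only [neg_eq_negs]
    rw [sum_B_eq_sum_signedWords (m + 1) fun w => x ^ negs w * (X : ℤ[X]) ^ invD w]
    exact sum_signedWords x X _ _ (by simp) (by simp)
  -- The terms with `neg σ` even are selected by `(1 ^ neg σ + (-1) ^ neg σ) / 2`.
  have hD : ∑ σ : D (m + 1), (X : ℤ[X]) ^ lengthD σ =
      ∑ σ : B (m + 1), if Even (neg σ) then (X : ℤ[X]) ^ invD (window σ) else 0 := by
    rw [← Finset.sum_filter]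
    simp only [lengthD_eq]
    exact (Finset.sum_subtype _ (fun σ => by simp [mem_D])
      fun σ : B (m + 1) => (X : ℤ[X]) ^ invD (window σ)).symm
  have h2 : (2 : ℤ[X]) * ∑ σ : D (m + 1), (X : ℤ[X]) ^ lengthD σ =
      ∏ j ∈ Finset.range (m + 1), ((1 + 1 * X ^ j) * qInt (j + 1)) +
        ∏ j ∈ Finset.range (m + 1), ((1 + -1 * X ^ j) * qInt (j + 1)) := by
    rw [← hsum, ← hsum, hD, Finset.mul_sum, ← Finset.sum_add_distrib]
    refine Finset.sum_congr rfl fun σ _ => ?_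
    split_ifs with he
    · rw [he.neg_one_pow, one_pow]; ring
    · rw [(Nat.not_even_iff_odd.1 he).neg_one_pow, one_pow]; ring
  have h3 : ∏ j ∈ Finset.range (m + 1), ((1 + -1 * X ^ j) * qInt (j + 1)) = 0 :=
    Finset.prod_eq_zero (Finset.mem_range.2 m.succ_pos) (by simp)
  refine mul_left_cancel₀ (two_ne_zero (α := ℤ[X])) ?_
  rw [h2, h3, add_zero, prod_qInt_two_mul, Finset.prod_mul_distrib, Finset.prod_range_succ',
    Finset.prod_range_succ (fun j => qInt (j + 1)), Finset.prod_mul_distrib]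
  simp only [one_mul, pow_zero, ← pow_succ']
  ring

end SignedPerm

theorem propositiont (n : ℕ) (hn : 1 ≤ n) :
    (∑ σ : SignedPerm.D n, (Polynomial.X : ℤ[X]) ^ SignedPerm.lengthD σ =
      ∑ σ : SignedPerm.B n with 0 < (SignedPerm.val σ (SignedPerm.pt n hn le_rfl) : ℤ),
        (Polynomial.X : ℤ[X]) ^ SignedPerm.lengthB σ) ∧
    (∑ σ : SignedPerm.D n, (Polynomial.X : ℤ[X]) ^ SignedPerm.lengthD σ =
      SignedPerm.qInt n * ∏ j ∈ Finset.Icc 1 (n - 1), SignedPerm.qInt (2 * j)) ∧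
    (∑ σ : SignedPerm.B n with 0 < (SignedPerm.val σ (SignedPerm.pt n hn le_rfl) : ℤ),
        (Polynomial.X : ℤ[X]) ^ SignedPerm.lengthB σ =
      SignedPerm.qInt n * ∏ j ∈ Finset.Icc 1 (n - 1), SignedPerm.qInt (2 * j)) := by
  obtain ⟨m, rfl⟩ := Nat.exists_eq_succ_of_ne_zero (by omega : n ≠ 0)
  have hB := SignedPerm.sum_lengthB m
  have hD := SignedPerm.sum_lengthD m
  exact ⟨hD.trans hB.symm, hD, hB⟩
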